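/- Let $\Omega\subset\mathbb R^2$ be a domain (a nonempty connected open set), let $\ell>0$, and let $H^1_\ell\Lambda^1(\Omega)$ be the Hilbert space of 1-forms $\alpha=\alpha_1\,dx_1+\alpha_2\,dx_2$ on $\Omega$ whose coefficients and their weak first derivatives lie in $L^2(\Omega)$, with inner product $$(\alpha,\beta)=\int_\Omega\Big(\sum_i\alpha_i\beta_i+\ell^2\sum_{i,j}\partial_j\alpha_i\,\partial_j\beta_i\Big)\,dx_1\,dx_2 .$$ Let $S^1=\mathbb R/\mathbb Z$. A Lipschitz immersion is a Lipschitz map $\phi\colon S^1\to\Omega$ whose tangent vector $\phi'(t)$ is nonzero wherever it is defined. Its current is the functional $[\phi]\colon H^1_\ell\Lambda^1(\Omega)\to\mathbb R$, $$[\phi](\alpha)=\int_{S^1}\phi^*\alpha=\int_0^1\sum_i\alpha_i(\phi(t))\,\phi_i'(t)\,dt ,$$ where the integral is taken literally if $\alpha$ has a continuous representative and is extended by continuity in the $H^1_\ell$ norm to the other forms. A self-intersection of $\phi$ is a point $x=\phi(s)=\phi(t)$ with $s\neq t$ in $S^1$. Let $\phi_1,\phi_2\colon S^1\to\Omega$ be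 Lipschitz immersions, each of which has only finitely many self-intersections and is such that, at each self-intersection $x$: - for every $t\in S^1$ with $\phi(t)=x$, the tangent vector $\phi'$ is defined at $t$ and is continuous at $t$ (as a function on the set of parameters where it is defined); - for all $s\ne t$ in $S^1$ with $\phi(s)=\phi(t)=x$, the unit tangent vectors $\phi'(s)/\|\phi'(s)\|$ and $\phi'(t)/\|\phi'(t)\|$ are distinct. If $[\phi_1]=[\phi_2]$ on $H^1_\ell\Lambda^1(\Omega)$, then $\phi_1$ and $\phi_2$ represent the same oriented shape: there is an orientation-preserving homeomorphism $\psi\colon S^1\to S^1$ with $\phi_2=\phi_1\circ\psi$. -/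

import Mathlib

open MeasureTheory Set Filter Topology
open scoped ContDiff

noncomputable section

namespace ShapeCurrent

/-- The Euclidean plane. -/
abbrev Plane : Type := EuclideanSpace ℝ (Fin 2)

/-- The space `L²(Ω)` of real functions. -/
abbrev L2 (Ω : Set Plane) : Type := Lp ℝ 2 ((volume : Measure Plane).restrict Ω)

/-- The partial derivative `∂ⱼ η` of a (smooth) function on the plane. -/
def partialDeriv (j : Fin 2) (η : Plane → ℝ) (x : Plane) : ℝ :=
  fderiv ℝ η x (EuclideanSpace.single j 1)

/-- `η` is a test function on `Ω`: smooth, with compact support contained in `Ω`. -/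
def IsTestFunction (Ω : Set Plane) (η : Plane → ℝ) : Prop :=
  ContDiff ℝ ∞ η ∧ HasCompactSupport η ∧ tsupport η ⊆ Ω

/-- `g` is the weak partial derivative `∂ⱼ f` on `Ω`. -/
def IsWeakPartial (Ω : Set Plane) (j : Fin 2) (f g : L2 Ω) : Prop :=
  ∀ η : Plane → ℝ, IsTestFunction Ω η →
    ∫ x in Ω, f x * partialDeriv j η x = - ∫ x in Ω, g x * η x

lemma IsTestFunction.memLp {Ω : Set Plane} {η : Plane → ℝ} (h : IsTestFunction Ω η) :
    MemLp η 2 ((volume : Measure Plane).restrict Ω) :=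
  (h.1.continuous.memLp_of_hasCompactSupport h.2.1).restrict Ω

lemma IsTestFunction.memLp_partialDeriv {Ω : Set Plane} {η : Plane → ℝ}
    (h : IsTestFunction Ω η) (j : Fin 2) :
    MemLp (partialDeriv j η) 2 ((volume : Measure Plane).restrict Ω) := by
  have hc : Continuous (partialDeriv j η) :=
    (h.1.continuous_fderiv (by simp)).clm_apply continuous_const
  have hs : HasCompactSupport (partialDeriv j η) :=
    (h.2.1.fderiv (𝕜 := ℝ)).comp_left
      (g := fun L : Plane →L[ℝ] ℝ => L (EuclideanSpace.single j 1)) (by simp)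
  exact (hc.memLp_of_hasCompactSupport hs).restrict Ω

lemma integral_add_mul {Ω : Set Plane} (f g : L2 Ω) {k : Plane → ℝ}
    (hk : MemLp k 2 ((volume : Measure Plane).restrict Ω)) :
    ∫ x in Ω, (f + g : L2 Ω) x * k x = (∫ x in Ω, f x * k x) + ∫ x in Ω, g x * k x := by
  have hf : Integrable (fun x => f x * k x) ((volume : Measure Plane).restrict Ω) :=
    (Lp.memLp f).integrable_mul hk
  have hg : Integrable (fun x => g x * k x) ((volume : Measure Plane).restrict Ω) :=
    (Lp.memLp g).integrable_mul hk
  rw [← integral_add hf hg]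
  refine integral_congr_ae ?_
  filter_upwards [Lp.coeFn_add f g] with x hx
  rw [hx, Pi.add_apply, add_mul]

lemma integral_smul_mul {Ω : Set Plane} (c : ℝ) (f : L2 Ω) (k : Plane → ℝ) :
    ∫ x in Ω, (c • f : L2 Ω) x * k x = c * ∫ x in Ω, f x * k x := by
  rw [← integral_const_mul]
  refine integral_congr_ae ?_
  filter_upwards [Lp.coeFn_smul c f] with x hx
  simp [hx, mul_assoc]

lemma IsWeakPartial.add {Ω : Set Plane} {j : Fin 2} {f g f' g' : L2 Ω}
    (h : IsWeakPartial Ω j f g) (h' : IsWeakPartial Ω j f' g') :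
    IsWeakPartial Ω j (f + f') (g + g') := by
  intro η hη
  rw [integral_add_mul f f' (hη.memLp_partialDeriv j), integral_add_mul g g' hη.memLp,
    h η hη, h' η hη]
  ring

lemma IsWeakPartial.smul {Ω : Set Plane} {j : Fin 2} {f g : L2 Ω} (c : ℝ)
    (h : IsWeakPartial Ω j f g) : IsWeakPartial Ω j (c • f) (c • g) := by
  intro η hη
  rw [integral_smul_mul, integral_smul_mul, h η hη]
  ring

/-- The space `H¹_ℓ Λ¹(Ω)` of 1-forms `α = α₀ dx₀ + α₁ dx₁` on `Ω` whose coefficients and their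
weak first derivatives are in `L²(Ω)`.  The form `α` is stored as the family with entries `αᵢ` at
`(i, none)` and `ℓ ∂ⱼαᵢ` at `(i, some j)`, so that the inner product inherited from the ambient
`ℓ²`-product is `∑ᵢ ∫ αᵢ βᵢ + ℓ² ∑ᵢⱼ ∫ (∂ⱼαᵢ) (∂ⱼβᵢ)`. -/
def H1Forms (ℓ : ℝ) (Ω : Set Plane) :
    Submodule ℝ (PiLp 2 (fun _ : Fin 2 × Option (Fin 2) => L2 Ω)) where
  carrier := {α | ∀ i j : Fin 2, IsWeakPartial Ω j (α (i, none)) (ℓ⁻¹ • α (i, some j))}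
  zero_mem' := by
    intro i j
    have h : IsWeakPartial Ω j (0 : L2 Ω) (0 : L2 Ω) := by
      have h0 : ∀ k : Plane → ℝ, ∫ x in Ω, (0 : L2 Ω) x * k x = 0 := fun k => by
        simpa using integral_smul_mul (0 : ℝ) (0 : L2 Ω) k
      intro η _
      rw [h0, h0, neg_zero]
    simpa using h
  add_mem' := by
    intro α β hα hβ i j
    simpa [smul_add] using (hα i j).add (hβ i j)
  smul_mem' := by
    intro c α hα i j
    have h := (hα i j).smul c
    rw [smul_comm] at h
    simpa using h

/-- `a = (a₀, a₁)` is a representative of the coefficients of `α` that is continuous on `Ω`. -/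
def IsContinuousRep {ℓ : ℝ} {Ω : Set Plane} (α : H1Forms ℓ Ω) (a : Fin 2 → Plane → ℝ) : Prop :=
  ∀ i : Fin 2, ContinuousOn (a i) Ω ∧
    a i =ᵐ[(volume : Measure Plane).restrict Ω]
      ((α : PiLp 2 (fun _ : Fin 2 × Option (Fin 2) => L2 Ω)) (i, none) : L2 Ω)

/-- The forms in `H¹_ℓ Λ¹(Ω)` that have a continuous representative (a dense subspace). -/
def continuousForms (ℓ : ℝ) (Ω : Set Plane) : Set (H1Forms ℓ Ω) :=
  {α | ∃ a, IsContinuousRep α a}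

/-- A curve on the circle `ℝ / ℤ` as a `1`-periodic function of a real parameter. -/
def lift (φ : UnitAddCircle → Plane) (t : ℝ) : Plane := φ (t : UnitAddCircle)

/-- The integral `∫_{S¹} φ^* a = ∫₀¹ ∑ᵢ aᵢ(φ(t)) φᵢ'(t) dt` of the 1-form `a₀ dx₀ + a₁ dx₁`
along the curve `φ`. -/
def pullbackIntegral (φ : UnitAddCircle → Plane) (a : Fin 2 → Plane → ℝ) : ℝ :=
  ∫ t in (0 : ℝ)..1, ∑ i : Fin 2, a i (lift φ t) * deriv (lift φ) t i

open Classical in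
/-- The current of `φ` on forms with a continuous representative: the integral of that
representative (on an open `Ω` it is unique). -/
def preCurrent (ℓ : ℝ) (Ω : Set Plane) (φ : UnitAddCircle → Plane) (α : H1Forms ℓ Ω) : ℝ :=
  if h : ∃ a, IsContinuousRep α a then pullbackIntegral φ h.choose else 0

open Classical in
/-- The current `[φ] : H¹_ℓ Λ¹(Ω) → ℝ`, `[φ](α) = ∫_{S¹} φ^* α`.  The integral is literal for
forms with a continuous representative; on the other forms, whose values along the curve are
traces, it is the extension by continuity in the norm of `H¹_ℓ Λ¹(Ω)`. -/
def current (ℓ : ℝ) (Ω : Set Plane) (φ : UnitAddCircle → Plane) (α : H1Forms ℓ Ω) : ℝ :=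
  if α ∈ continuousForms ℓ Ω then preCurrent ℓ Ω φ α
  else extendFrom (continuousForms ℓ Ω) (preCurrent ℓ Ω φ) α

/-- Lipschitz immersions `S¹ → Ω`: Lipschitz curves whose tangent vector `φ'` is nonzero wherever
it is defined. -/
structure IsLipImm (Ω : Set Plane) (φ : UnitAddCircle → Plane) : Prop where
  mem : ∀ θ, φ θ ∈ Ω
  lipschitz : ∃ K, LipschitzWith K φ
  deriv_ne_zero : ∀ t : ℝ, DifferentiableAt ℝ (lift φ) t → deriv (lift φ) t ≠ 0

/-- The points of the plane through which the curve passes more than once. -/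
def selfIntersections (φ : UnitAddCircle → Plane) : Set Plane :=
  {x | ∃ θ₁ θ₂ : UnitAddCircle, θ₁ ≠ θ₂ ∧ φ θ₁ = x ∧ φ θ₂ = x}

/-- The tangent vector `φ'` is defined at the parameter `t` and, as a function on the set of
parameters where it is defined, continuous there. -/
def TangentContinuousAt (φ : UnitAddCircle → Plane) (t : ℝ) : Prop :=
  DifferentiableAt ℝ (lift φ) t ∧
    ContinuousWithinAt (deriv (lift φ)) {u | DifferentiableAt ℝ (lift φ) u} t

/-- The unit tangent vector `φ'(t) / ‖φ'(t)‖`. -/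
def unitTangent (φ : UnitAddCircle → Plane) (t : ℝ) : Plane :=
  ‖deriv (lift φ) t‖⁻¹ • deriv (lift φ) t

/-- The curve has finitely many self-intersections; whenever it passes through one of them, its
tangent vector is continuous, and the tangents of different passages point in different
directions. -/
structure HasGoodSelfIntersections (φ : UnitAddCircle → Plane) : Prop where
  finite : (selfIntersections φ).Finite
  tangent_continuous : ∀ t : ℝ, lift φ t ∈ selfIntersections φ → TangentContinuousAt φ t
  tangent_distinct : ∀ s t : ℝ, (s : UnitAddCircle) ≠ (t : UnitAddCircle) →
    lift φ s = lift φ t → unitTangent φ s ≠ unitTangent φ t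

/-- A homeomorphism of the circle `ℝ / ℤ` that preserves the orientation: it lifts to a
continuous strictly increasing function on the line that commutes with the unit translation. -/
def IsOrientationPreserving (ψ : UnitAddCircle ≃ₜ UnitAddCircle) : Prop :=
  ∃ f : ℝ → ℝ, Continuous f ∧ StrictMono f ∧ (∀ t, f (t + 1) = f t + 1) ∧
    ∀ t : ℝ, ψ (t : UnitAddCircle) = (f t : UnitAddCircle)

/-- Two curves represent the same oriented shape if they differ by a sense-preserving
reparameterization. -/
def SameOrientedShape (φ₁ φ₂ : UnitAddCircle → Plane) : Prop :=
  ∃ ψ : UnitAddCircle ≃ₜ UnitAddCircle, IsOrientationPreserving ψ ∧ φ₂ = φ₁ ∘ ψ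

end ShapeCurrent

end

namespace ShapeCurrent

/-! ### Coordinate forms and the current on compact sets -/

/-! The currents are compared only on the forms `η dxᵢ` with `η` a test function, where they are
literal integrals. Letting `η` tend to the indicator of a compact `B ⊆ Ω` shows that both curves
give `B` the same vector mass `∫ 1_B(φ) φ'` (`integral_indicator_eq_of_current_eq`). A simple arc
has its displacement as mass (`integral_indicator_arc`), and this is nonzero. Hence neither curve
can leave the trace of the other (`SameMass.range_subset`), nor can a simple arc of one be run
backwards by the other (`SameMass.not_antitone`).

The rest is geometry of curves parameterized by arc length. Off the finite set `X` of all
self-intersections, one curve is locally the other after a continuous injective change of parameter.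
This change is increasing, since reversal is excluded, and it preserves length, so it is a
translation (`IsArcCurve.eventually_eq`). At a passage through `X`, the translations on the two
sides agree modulo the length: at a common self-intersection the distinct tangent directions force
this, and otherwise one of the curves passes only once through the point
(`IsArcCurve.translation_unique`). Connectedness of the line gives one global translation, and
undoing the arc length parameterizations turns it into the homeomorphism of the circle. -/

lemma IsTestFunction.setIntegral_mul {Ω : Set Plane} {ζ : Plane → ℝ} (hζ : IsTestFunction Ω ζ)
    (k : Plane → ℝ) : ∫ x in Ω, k x * ζ x = ∫ x, k x * ζ x := by
  refine setIntegral_eq_integral_of_forall_compl_eq_zero fun x hx => ?_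
  rw [image_eq_zero_of_notMem_tsupport (fun h => hx (hζ.2.2 h)), mul_zero]

lemma IsTestFunction.setIntegral_mul_partialDeriv {Ω : Set Plane} {ζ : Plane → ℝ}
    (hζ : IsTestFunction Ω ζ) (k : Plane → ℝ) (j : Fin 2) :
    ∫ x in Ω, k x * partialDeriv j ζ x = ∫ x, k x * partialDeriv j ζ x := by
  refine setIntegral_eq_integral_of_forall_compl_eq_zero fun x hx => ?_
  have h : fderiv ℝ ζ x = 0 := image_eq_zero_of_notMem_tsupport
    fun h => hx (hζ.2.2 (tsupport_fderiv_subset ℝ h))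
  simp [partialDeriv, h]

lemma IsTestFunction.continuous_partialDeriv {Ω : Set Plane} {η : Plane → ℝ}
    (hη : IsTestFunction Ω η) (j : Fin 2) : Continuous (partialDeriv j η) :=
  (hη.1.continuous_fderiv (by simp)).clm_apply continuous_const

/-- Since `ζ` vanishes off `Ω`, the integrals extend to the whole plane, where integration by parts
has no boundary term. -/
lemma IsTestFunction.isWeakPartial {Ω : Set Plane} {η : Plane → ℝ} (hη : IsTestFunction Ω η)
    (j : Fin 2) :
    IsWeakPartial Ω j (hη.memLp.toLp η) ((hη.memLp_partialDeriv j).toLp (partialDeriv j η)) := by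
  intro ζ hζ
  have e₁ : ∫ x in Ω, hη.memLp.toLp η x * partialDeriv j ζ x
      = ∫ x in Ω, η x * partialDeriv j ζ x := by
    refine integral_congr_ae ?_
    filter_upwards [hη.memLp.coeFn_toLp] with x hx
    rw [hx]
  have e₂ : ∫ x in Ω, (hη.memLp_partialDeriv j).toLp (partialDeriv j η) x * ζ x
      = ∫ x in Ω, partialDeriv j η x * ζ x := by
    refine integral_congr_ae ?_
    filter_upwards [(hη.memLp_partialDeriv j).coeFn_toLp] with x hx
    rw [hx]
  rw [e₁, e₂, hζ.setIntegral_mul, hζ.setIntegral_mul_partialDeriv]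
  have cη := hη.1.continuous
  have cζ := hζ.1.continuous
  have cη' := hη.continuous_partialDeriv j
  have cζ' := hζ.continuous_partialDeriv j
  exact integral_mul_fderiv_eq_neg_fderiv_mul_of_integrable
    ((cη'.mul cζ).integrable_of_hasCompactSupport hζ.2.1.mul_left)
    ((cη.mul cζ').integrable_of_hasCompactSupport hη.2.1.mul_right)
    ((cη.mul cζ).integrable_of_hasCompactSupport hζ.2.1.mul_left)
    (fun x _ => hη.1.differentiable (by simp) x) (fun x _ => hζ.1.differentiable (by simp) x)

/-- The form `η dxᵢ` of a test function `η`. -/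
noncomputable def coordForm {ℓ : ℝ} (hℓ : 0 < ℓ) {Ω : Set Plane} {η : Plane → ℝ} (hη : IsTestFunction Ω η)
    (i : Fin 2) : H1Forms ℓ Ω :=
  ⟨WithLp.toLp 2 fun p => if p.1 = i then
      p.2.elim (hη.memLp.toLp η) fun j => ℓ • (hη.memLp_partialDeriv j).toLp (partialDeriv j η)
    else 0, by
    intro k j
    by_cases hk : k = i
    · simpa [hk, smul_smul, inv_mul_cancel₀ hℓ.ne'] using hη.isWeakPartial j
    · simpa [hk] using (hη.isWeakPartial j).smul 0⟩

lemma isContinuousRep_coordForm {ℓ : ℝ} (hℓ : 0 < ℓ) {Ω : Set Plane} {η : Plane → ℝ}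
    (hη : IsTestFunction Ω η) (i : Fin 2) :
    IsContinuousRep (coordForm hℓ hη i) fun k => if k = i then η else 0 := by
  intro k
  by_cases hk : k = i
  · simpa [coordForm, hk] using ⟨hη.1.continuous.continuousOn, hη.memLp.coeFn_toLp.symm⟩
  · simpa [coordForm, hk] using ⟨continuousOn_const, (Lp.coeFn_zero ℝ 2 _).symm⟩

lemma IsContinuousRep.eqOn {ℓ : ℝ} {Ω : Set Plane} (hΩ : IsOpen Ω) {α : H1Forms ℓ Ω}
    {a b : Fin 2 → Plane → ℝ} (ha : IsContinuousRep α a) (hb : IsContinuousRep α b) (i : Fin 2) :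
    EqOn (a i) (b i) Ω :=
  Measure.eqOn_open_of_ae_eq ((ha i).2.trans (hb i).2.symm) hΩ (ha i).1 (hb i).1

/-- The continuous representative picked by choice agrees with `η dxᵢ` on all of the open set `Ω`,
hence along the curve. -/
lemma current_coordForm {ℓ : ℝ} (hℓ : 0 < ℓ) {Ω : Set Plane} (hΩ : IsOpen Ω)
    {φ : UnitAddCircle → Plane} (hφ : ∀ θ, φ θ ∈ Ω) {η : Plane → ℝ} (hη : IsTestFunction Ω η)
    (i : Fin 2) :
    current ℓ Ω φ (coordForm hℓ hη i)
      = ∫ t in (0 : ℝ)..1, η (lift φ t) * deriv (lift φ) t i := by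
  have hrep := isContinuousRep_coordForm hℓ hη i
  have hex : ∃ a, IsContinuousRep (coordForm hℓ hη i) a := ⟨_, hrep⟩
  have hmem : coordForm hℓ hη i ∈ continuousForms ℓ Ω := hex
  rw [current, if_pos hmem, preCurrent, dif_pos hex, pullbackIntegral]
  refine intervalIntegral.integral_congr fun t _ => ?_
  have h : ∀ k, hex.choose k (lift φ t) = (if k = i then η else 0) (lift φ t) :=
    fun k => hex.choose_spec.eqOn hΩ hrep k (hφ _)
  simp only [h]
  rw [Finset.sum_eq_single i]
  · simp
  · intro k _ hk
    simp [hk]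
  · simp

lemma lipschitzWith_lift {φ : UnitAddCircle → Plane} {K : NNReal} (hφ : LipschitzWith K φ) :
    LipschitzWith K (lift φ) := by
  have h : LipschitzWith 1 (fun t : ℝ => (t : UnitAddCircle)) := by
    refine LipschitzWith.of_dist_le_mul fun s t => ?_
    rw [dist_eq_norm, dist_eq_norm, ← AddCircle.coe_sub, NNReal.coe_one, one_mul]
    exact QuotientAddGroup.norm_mk_le_norm
  have h' := hφ.comp h
  rw [mul_one] at h'
  exact h'

lemma norm_deriv_coord_le {φ : UnitAddCircle → Plane} {K : NNReal} (hφ : LipschitzWith K φ)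
    (t : ℝ) (i : Fin 2) : ‖deriv (lift φ) t i‖ ≤ K :=
  (PiLp.norm_apply_le _ i).trans (norm_deriv_le_of_lipschitz (lipschitzWith_lift hφ))

lemma measurable_deriv_coord (f : ℝ → Plane) (i : Fin 2) : Measurable fun t => deriv f t i :=
  (EuclideanSpace.proj (𝕜 := ℝ) i).continuous.measurable.comp (measurable_deriv f)

/-- Take smooth bumps equal to 1 on `B` and supported in shrinking thickenings of `B`. As `B` is
closed, a point off `B` eventually lies outside them. -/
lemma exists_testFunction_seq {Ω B : Set Plane} (hΩ : IsOpen Ω) (hB : IsCompact B) (hBΩ : B ⊆ Ω) :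
    ∃ g : ℕ → Plane → ℝ, (∀ n, IsTestFunction Ω (g n)) ∧ (∀ n x, ‖g n x‖ ≤ 1) ∧
      ∀ x, Tendsto (fun n => g n x) atTop (𝓝 (B.indicator 1 x)) := by
  obtain ⟨δ, δpos, hδ⟩ := hB.exists_cthickening_subset_open hΩ hBΩ
  obtain ⟨u, -, u_pos, u_lim⟩ : ∃ u : ℕ → ℝ, StrictAnti u ∧ (∀ n : ℕ, u n ∈ Ioo 0 δ)
    ∧ Tendsto u atTop (𝓝 0) := exists_seq_strictAnti_tendsto' δpos
  have key : ∀ n, ∃ g : Plane → ℝ, Function.support g = Metric.thickening (u n) B ∧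
      ContDiff ℝ ∞ g ∧ range g ⊆ Icc 0 1 ∧ ∀ x ∈ B, g x = 1 := by
    intro n
    obtain ⟨g, g_smooth, g_range, g_supp, hg⟩ :=
      exists_contMDiff_support_eq_eq_one_iff (n := ⊤) (modelWithCornersSelf ℝ Plane)
        Metric.isOpen_thickening hB.isClosed (Metric.self_subset_thickening (u_pos n).1 B)
    exact ⟨g, g_supp, g_smooth.contDiff, g_range, fun x hx => (hg x).1 hx⟩
  choose g g_supp g_diff g_range hg using key
  have hts : ∀ n, tsupport (g n) ⊆ Metric.cthickening δ B := fun n =>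
    closure_minimal (g_supp n ▸ Metric.thickening_subset_cthickening_of_le (u_pos n).2.le _)
      Metric.isClosed_cthickening
  refine ⟨g, fun n => ⟨g_diff n, ?_, (hts n).trans hδ⟩, fun n x => ?_, fun x => ?_⟩
  · exact hB.cthickening.of_isClosed_subset (isClosed_tsupport _) (hts n)
  · have := g_range n (mem_range_self x)
    rw [Real.norm_of_nonneg this.1]
    exact this.2
  · by_cases hx : x ∈ B
    · simp [hg _ x hx, hx]
    · rw [indicator_of_notMem hx]
      apply tendsto_const_nhds.congr'
      obtain ⟨ε, εpos, hε⟩ : ∃ ε, 0 < ε ∧ x ∉ Metric.thickening ε B := by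
        rw [← hB.isClosed.closure_eq, Metric.closure_eq_iInter_thickening B] at hx
        simpa using hx
      filter_upwards [(tendsto_order.1 u_lim).2 _ εpos] with n hn
      symm
      rw [← Function.notMem_support, g_supp]
      exact fun h => hε (Metric.thickening_mono hn.le B h)

lemma tendsto_integral_comp_mul_deriv {φ : UnitAddCircle → Plane} {K : NNReal}
    (hφ : LipschitzWith K φ) {B : Set Plane} {g : ℕ → Plane → ℝ} (hg : ∀ n, Continuous (g n))
    (hg1 : ∀ n x, ‖g n x‖ ≤ 1)
    (hgB : ∀ x, Tendsto (fun n => g n x) atTop (𝓝 (B.indicator 1 x))) (i : Fin 2) :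
    Tendsto (fun n => ∫ t in (0 : ℝ)..1, g n (lift φ t) * deriv (lift φ) t i) atTop
      (𝓝 (∫ t in (0 : ℝ)..1, B.indicator 1 (lift φ t) * deriv (lift φ) t i)) := by
  refine intervalIntegral.tendsto_integral_filter_of_dominated_convergence (fun _ => (K : ℝ))
    (Eventually.of_forall fun n => ?_) (Eventually.of_forall fun n => ?_) (by simp) ?_
  · exact (((hg n).comp (lipschitzWith_lift hφ).continuous).measurable.mul
      (measurable_deriv_coord _ i)).aestronglyMeasurable
  · refine Eventually.of_forall fun t _ => ?_
    rw [norm_mul]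
    exact (mul_le_of_le_one_left (norm_nonneg _) (hg1 n _)).trans (norm_deriv_coord_le hφ t i)
  · exact Eventually.of_forall fun t _ => (hgB _).mul_const _

/-- Equal currents give the same vector mass to every compact set. -/
lemma integral_indicator_eq_of_current_eq {ℓ : ℝ} (hℓ : 0 < ℓ) {Ω : Set Plane} (hΩ : IsOpen Ω)
    {φ₁ φ₂ : UnitAddCircle → Plane} (h₁ : IsLipImm Ω φ₁) (h₂ : IsLipImm Ω φ₂)
    (h : current ℓ Ω φ₁ = current ℓ Ω φ₂) {B : Set Plane} (hB : IsCompact B) (hBΩ : B ⊆ Ω)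
    (i : Fin 2) :
    ∫ t in (0 : ℝ)..1, B.indicator 1 (lift φ₁ t) * deriv (lift φ₁) t i
      = ∫ t in (0 : ℝ)..1, B.indicator 1 (lift φ₂ t) * deriv (lift φ₂) t i := by
  obtain ⟨K₁, hK₁⟩ := h₁.lipschitz
  obtain ⟨K₂, hK₂⟩ := h₂.lipschitz
  obtain ⟨g, hgt, hg1, hgB⟩ := exists_testFunction_seq hΩ hB hBΩ
  have hc := fun n => (hgt n).1.continuous
  have e : ∀ n, ∫ t in (0 : ℝ)..1, g n (lift φ₁ t) * deriv (lift φ₁) t i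
      = ∫ t in (0 : ℝ)..1, g n (lift φ₂ t) * deriv (lift φ₂) t i := fun n => by
    rw [← current_coordForm hℓ hΩ h₁.mem (hgt n) i, ← current_coordForm hℓ hΩ h₂.mem (hgt n) i, h]
  have T₁ := tendsto_integral_comp_mul_deriv hK₁ hc hg1 hgB i
  simp only [e] at T₁
  exact tendsto_nhds_unique T₁ (tendsto_integral_comp_mul_deriv hK₂ hc hg1 hgB i)

end ShapeCurrent

namespace ShapeCurrent

/-! ### Arcs of curves and their vector mass -/

lemma coe_circle_eq_iff {s t : ℝ} :
    (s : UnitAddCircle) = (t : UnitAddCircle) ↔ ∃ n : ℤ, s = t + n := by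
  rw [QuotientAddGroup.eq_iff_sub_mem, AddSubgroup.mem_zmultiples_iff]
  constructor
  · rintro ⟨n, hn⟩
    exact ⟨n, by simp at hn; linarith⟩
  · rintro ⟨n, hn⟩
    exact ⟨n, by simp; linarith⟩

lemma lift_add_one (φ : UnitAddCircle → Plane) (t : ℝ) : lift φ (t + 1) = lift φ t := by
  simp [lift]

lemma lift_injective_of_notMem {φ : UnitAddCircle → Plane} {s t : ℝ} (h : lift φ s = lift φ t)
    (hs : lift φ s ∉ selfIntersections φ) : ∃ n : ℤ, s = t + n := by
  rw [← coe_circle_eq_iff]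
  by_contra hne
  exact hs ⟨_, _, hne, rfl, h.symm⟩

lemma deriv_lift_add_one (φ : UnitAddCircle → Plane) (t : ℝ) :
    deriv (lift φ) (t + 1) = deriv (lift φ) t := by
  rw [← deriv_comp_add_const]
  congr 1
  exact funext (lift_add_one φ)

/-- Lipschitz coordinates are absolutely continuous, so the fundamental theorem of calculus applies.
-/
lemma integral_deriv_coord {φ : UnitAddCircle → Plane} {K : NNReal} (hφ : LipschitzWith K φ)
    (c d : ℝ) (i : Fin 2) : ∫ t in c..d, deriv (lift φ) t i = lift φ d i - lift φ c i := by
  have hL := lipschitzWith_lift hφ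
  have hi : LipschitzWith K fun t => lift φ t i := by
    refine LipschitzWith.of_dist_le_mul fun s t => ?_
    refine le_trans ?_ (hL.dist_le_mul s t)
    rw [dist_eq_norm, dist_eq_norm, ← PiLp.sub_apply]
    exact PiLp.norm_apply_le _ i
  have h := (hi.lipschitzOnWith (s := uIcc c d)).absolutelyContinuousOnInterval.integral_deriv_eq_sub
  rw [← h]
  refine intervalIntegral.integral_congr_ae ?_
  filter_upwards [hL.ae_differentiableAt_real] with t ht _
  exact ((hasDerivAt_pi.1 ((EuclideanSpace.equiv (Fin 2) ℝ).hasFDerivAt.comp_hasDerivAt t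
    ht.hasDerivAt)) i).deriv.symm

lemma not_intCast_mem_Ioo {n : ℤ} (h₀ : 0 < (n : ℝ)) (h₁ : (n : ℝ) < 1) : False := by
  have h₀' : 0 < n := by exact_mod_cast h₀
  have h₁' : n < 1 := by exact_mod_cast h₁
  omega

/-- The vector mass of a simple arc of the curve is the difference of its end points. -/
lemma integral_indicator_arc {φ : UnitAddCircle → Plane} {K : NNReal} (hφ : LipschitzWith K φ)
    {c d : ℝ} (hcd : c ≤ d) (hd : d < c + 1)
    (hreg : ∀ t ∈ Icc c d, lift φ t ∉ selfIntersections φ) (i : Fin 2) :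
    ∫ t in (0 : ℝ)..1, (lift φ '' Icc c d).indicator 1 (lift φ t) * deriv (lift φ) t i
      = lift φ d i - lift φ c i := by
  set B := lift φ '' Icc c d with hB
  set h : ℝ → ℝ := fun t => B.indicator 1 (lift φ t) * deriv (lift φ) t i with hh
  have hper : Function.Periodic h 1 := fun t => by
    simp only [hh, lift_add_one, deriv_lift_add_one]
  have hBm : MeasurableSet B :=
    (isCompact_Icc.image (lipschitzWith_lift hφ).continuous).isClosed.measurableSet
  have hmeas : Measurable h :=
    ((measurable_const.indicator hBm).comp (lipschitzWith_lift hφ).continuous.measurable).mul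
      (measurable_deriv_coord _ i)
  have hint : ∀ a b, IntervalIntegrable h volume a b := fun a b => by
    rw [intervalIntegrable_iff]
    refine Measure.integrableOn_of_bounded (M := K) (by simp) hmeas.aestronglyMeasurable
      (Eventually.of_forall fun t => ?_)
    refine le_trans ?_ (norm_deriv_coord_le hφ t i)
    rw [hh]
    by_cases ht : lift φ t ∈ B <;> simp [ht]
  -- Integrate over the period `[c, c + 1]` instead, so that the arc is its initial piece.
  have e₀ := hper.intervalIntegral_add_eq 0 c
  rw [zero_add] at e₀
  rw [e₀, ← intervalIntegral.integral_add_adjacent_intervals (hint c d) (hint d (c + 1))]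
  have e₁ : ∫ t in c..d, h t = ∫ t in c..d, deriv (lift φ) t i := by
    refine intervalIntegral.integral_congr fun t ht => ?_
    rw [uIcc_of_le hcd] at ht
    simp [hh, hB, mem_image_of_mem (lift φ) ht]
  have e₂ : ∫ t in d..(c + 1), h t = 0 := by
    refine intervalIntegral.integral_zero_ae ?_
    -- The end point `c + 1` returns to `φ(c) ∈ B` and has to be discarded as a null set.
    have hae : ∀ᵐ t : ℝ, t ≠ c + 1 := by simp [ae_iff]
    filter_upwards [hae] with t hne ht
    rw [uIoc_of_le hd.le] at ht
    have hlt : t < c + 1 := lt_of_le_of_ne ht.2 hne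
    have : lift φ t ∉ B := by
      rintro ⟨u, hu, hut⟩
      obtain ⟨n, hn⟩ := lift_injective_of_notMem hut (hreg u hu)
      have h1 : -1 < (n : ℝ) := by linarith [hu.1]
      have h2 : (n : ℝ) < 0 := by linarith [hu.2, ht.1]
      have h1' : -1 < n := by exact_mod_cast h1
      have h2' : n < 0 := by exact_mod_cast h2
      omega
    simp [hh, this]
  rw [e₁, e₂, add_zero, integral_deriv_coord hφ]

/-- At a self-intersection the nonzero derivative isolates the passage. At any other point of the
curve, injectivity modulo 1 does. -/
lemma HasGoodSelfIntersections.eventually_ne {Ω : Set Plane} {φ : UnitAddCircle → Plane}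
    (hφ : IsLipImm Ω φ) (hs : HasGoodSelfIntersections φ) (t : ℝ) (x : Plane) :
    ∀ᶠ s in 𝓝[≠] t, lift φ s ≠ x := by
  obtain ⟨K, hK⟩ := hφ.lipschitz
  by_cases hx : lift φ t = x
  · subst hx
    by_cases hS : lift φ t ∈ selfIntersections φ
    · have hd := (hs.tangent_continuous t hS).1
      exact hd.hasDerivAt.eventually_ne (hφ.deriv_ne_zero t hd)
    · have h1 : ∀ᶠ s in 𝓝[≠] t, s ∈ Ioo (t - 1) (t + 1) :=
        mem_nhdsWithin_of_mem_nhds (Ioo_mem_nhds (by linarith) (by linarith))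
      filter_upwards [h1, self_mem_nhdsWithin] with s hs1 hne heq
      obtain ⟨n, hn⟩ := lift_injective_of_notMem heq (heq ▸ hS)
      have h1 : -1 < (n : ℝ) := by linarith [hs1.1]
      have h2 : (n : ℝ) < 1 := by linarith [hs1.2]
      have h1' : -1 < n := by exact_mod_cast h1
      have h2' : n < 1 := by exact_mod_cast h2
      obtain rfl : n = 0 := by omega
      exact hne (by simpa using hn)
  · exact mem_nhdsWithin_of_mem_nhds
      ((lipschitzWith_lift hK).continuous.continuousAt.eventually_ne hx)

lemma HasGoodSelfIntersections.eventually_notMem {Ω : Set Plane} {φ : UnitAddCircle → Plane}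
    (hφ : IsLipImm Ω φ) (hs : HasGoodSelfIntersections φ) {X : Set Plane} (hX : X.Finite) (t : ℝ) :
    ∀ᶠ s in 𝓝[≠] t, lift φ s ∉ X := by
  have h := (hX.eventually_all (l := 𝓝[≠] t) (p := fun x s => lift φ s ≠ x)).2
    fun x _ => hs.eventually_ne hφ t x
  filter_upwards [h] with s hs' hmem
  exact hs' _ hmem rfl

/-- The two curves give the same vector mass to every compact subset of `Ω`. -/
def SameMass (Ω : Set Plane) (φ₁ φ₂ : UnitAddCircle → Plane) : Prop :=
  ∀ B : Set Plane, IsCompact B → B ⊆ Ω → ∀ i : Fin 2,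
    ∫ t in (0 : ℝ)..1, B.indicator 1 (lift φ₁ t) * deriv (lift φ₁) t i
      = ∫ t in (0 : ℝ)..1, B.indicator 1 (lift φ₂ t) * deriv (lift φ₂) t i

/-- A short simple arc of `φ₂` off the closed trace of `φ₁` would have mass zero, so its end points
would coincide. -/
lemma SameMass.range_subset {Ω : Set Plane} {φ₁ φ₂ : UnitAddCircle → Plane}
    (hM : SameMass Ω φ₁ φ₂) (h₁ : IsLipImm Ω φ₁) (h₂ : IsLipImm Ω φ₂)
    (hs₂ : HasGoodSelfIntersections φ₂) : range (lift φ₂) ⊆ range (lift φ₁) := by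
  obtain ⟨K₁, hK₁⟩ := h₁.lipschitz
  obtain ⟨K₂, hK₂⟩ := h₂.lipschitz
  have hc₂ := (lipschitzWith_lift hK₂).continuous
  rintro _ ⟨t, rfl⟩
  by_contra ht
  have hrange : range (lift φ₁) = range φ₁ :=
    (QuotientAddGroup.mk_surjective (s := AddSubgroup.zmultiples (1 : ℝ))).range_comp φ₁
  have hclosed : IsClosed (range (lift φ₁)) := by
    rw [hrange]
    exact (isCompact_range hK₁.continuous).isClosed
  have e₁ : ∀ᶠ s in 𝓝[>] t, lift φ₂ s ∉ range (lift φ₁) :=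
    mem_nhdsWithin_of_mem_nhds (hc₂.continuousAt (hclosed.isOpen_compl.mem_nhds ht))
  -- The arc is taken strictly to the right of `t`, because `t` itself may be a self-intersection.
  have e₂ : ∀ᶠ s in 𝓝[>] t, lift φ₂ s ∉ selfIntersections φ₂ :=
    (hs₂.eventually_notMem h₂ hs₂.finite t).filter_mono
      (nhdsWithin_mono _ fun s hs => ne_of_gt hs)
  obtain ⟨u, hu, hsub⟩ := (mem_nhdsGT_iff_exists_Ioo_subset' (show t < t + 1 by linarith)).1
    (e₁.and e₂)
  have hut : t < u := hu
  obtain ⟨d, hd1, hd2⟩ := exists_between (show t < min u (t + 1) from lt_min hut (by linarith))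
  obtain ⟨c, hc1, hc2⟩ := exists_between hd1
  have hdu := lt_min_iff.1 hd2
  have hI : ∀ s ∈ Icc c d, lift φ₂ s ∉ range (lift φ₁) ∧ lift φ₂ s ∉ selfIntersections φ₂ :=
    fun s hs => hsub ⟨by linarith [hs.1], by linarith [hs.2]⟩
  have heq : lift φ₂ d = lift φ₂ c := by
    ext i
    have h := hM (lift φ₂ '' Icc c d) (isCompact_Icc.image hc₂)
      (by rintro _ ⟨s, -, rfl⟩; exact h₂.mem _) i
    rw [integral_indicator_arc hK₂ hc2.le (by linarith) (fun s hs => (hI s hs).2)] at h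
    have h0 : ∫ t in (0 : ℝ)..1, (lift φ₂ '' Icc c d).indicator 1 (lift φ₁ t)
        * deriv (lift φ₁) t i = 0 := by
      refine intervalIntegral.integral_zero_ae (Eventually.of_forall fun s _ => ?_)
      have : lift φ₁ s ∉ lift φ₂ '' Icc c d := by
        rintro ⟨v, hv, hvs⟩
        exact (hI v hv).1 ⟨s, hvs.symm⟩
      simp [this]
    linarith
  obtain ⟨n, hn⟩ := lift_injective_of_notMem heq (hI d (right_mem_Icc.2 hc2.le)).2
  exact not_intCast_mem_Ioo (by linarith) (by linarith)

/-- The two curves would give opposite displacements as the mass of the same arc, so its end points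
would coincide. -/
lemma SameMass.not_antitone {Ω : Set Plane} {φ₁ φ₂ : UnitAddCircle → Plane}
    (hM : SameMass Ω φ₁ φ₂) (h₁ : IsLipImm Ω φ₁) (h₂ : IsLipImm Ω φ₂) {a b : ℝ} (hab : a < b)
    (hb : b < a + 1)
    (hreg : ∀ t ∈ Icc a b, lift φ₂ t ∉ selfIntersections φ₁ ∪ selfIntersections φ₂)
    {g : ℝ → ℝ} (hg : ContinuousOn g (Icc a b)) (hanti : StrictAntiOn g (Icc a b))
    (hfg : ∀ t ∈ Icc a b, lift φ₁ (g t) = lift φ₂ t) : False := by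
  obtain ⟨K₁, hK₁⟩ := h₁.lipschitz
  obtain ⟨K₂, hK₂⟩ := h₂.lipschitz
  have ha' := left_mem_Icc.2 hab.le
  have hb' := right_mem_Icc.2 hab.le
  have himg : g '' Icc a b = Icc (g b) (g a) := by
    refine subset_antisymm ?_ ?_
    · rintro _ ⟨t, ht, rfl⟩
      exact ⟨hanti.antitoneOn ht hb' ht.2, hanti.antitoneOn ha' ht ht.1⟩
    · exact intermediate_value_Icc' hab.le hg
  have hlt : g b < g a := hanti ha' hb' hab
  have harc : lift φ₁ '' Icc (g b) (g a) = lift φ₂ '' Icc a b := by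
    rw [← himg, image_image]
    exact image_congr hfg
  have hreg₁ : ∀ s ∈ Icc (g b) (g a), lift φ₁ s ∉ selfIntersections φ₁ := by
    rw [← himg]
    rintro _ ⟨t, ht, rfl⟩ h
    exact hreg t ht (Or.inl (hfg t ht ▸ h))
  have hreg₂ : ∀ s ∈ Icc a b, lift φ₂ s ∉ selfIntersections φ₂ :=
    fun s hs h => hreg s hs (Or.inr h)
  -- The mass formula needs less than one turn. On a longer arc `g` would take the value `g b + 1`,
  -- so `φ₂` would meet its end point `φ₂(b)` a second time.
  have hshort : g a < g b + 1 := by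
    by_contra hcon
    push Not at hcon
    have hmem : g b + 1 ∈ g '' Icc a b := himg ▸ ⟨by linarith, hcon⟩
    obtain ⟨t, ht, hgt⟩ := hmem
    have hne : t ≠ b := by
      rintro rfl
      linarith
    have heq : lift φ₂ b = lift φ₂ t := by
      rw [← hfg t ht, ← hfg b hb', hgt, lift_add_one]
    obtain ⟨n, hn⟩ := lift_injective_of_notMem heq (hreg₂ b hb')
    have htb := lt_of_le_of_ne ht.2 hne
    exact not_intCast_mem_Ioo (by linarith) (by linarith [ht.1])
  have heq : lift φ₂ b = lift φ₂ a := by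
    ext i
    have h := hM (lift φ₂ '' Icc a b)
      (isCompact_Icc.image (lipschitzWith_lift hK₂).continuous)
      (by rintro _ ⟨s, -, rfl⟩; exact h₂.mem _) i
    rw [integral_indicator_arc hK₂ hab.le hb hreg₂, ← harc,
      integral_indicator_arc hK₁ hlt.le hshort hreg₁, hfg a ha', hfg b hb'] at h
    linarith
  obtain ⟨n, hn⟩ := lift_injective_of_notMem heq (hreg₂ b hb')
  exact not_intCast_mem_Ioo (by linarith) (by linarith)

end ShapeCurrent

namespace ShapeCurrent

/-! ### Periodic curves parameterized by arc length -/

/-- The curve `γ` passes through `γ t` in the direction of the unit vector `u`. -/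
def HasDirection (γ : ℝ → Plane) (t : ℝ) (u : Plane) : Prop :=
  Tendsto (fun s => ‖γ s - γ t‖⁻¹ • (γ s - γ t)) (𝓝[>] t) (𝓝 u) ∧
    Tendsto (fun s => ‖γ s - γ t‖⁻¹ • (γ s - γ t)) (𝓝[<] t) (𝓝 (-u))

/-- `γ` is a closed curve of length `L`, parameterized by arc length, with self-intersections
in `S ⊆ X`, which are passed in different directions; its passages through `X` are isolated. -/
structure IsArcCurve (γ : ℝ → Plane) (L : ℝ) (S X : Set Plane) : Prop where
  continuous : Continuous γ
  pos : 0 < L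
  periodic : Function.Periodic γ L
  speed : ∀ a b, a ≤ b → eVariationOn γ (Icc a b) = ENNReal.ofReal (b - a)
  subset : S ⊆ X
  inj : ∀ s t, γ s = γ t → γ s ∉ S → ∃ n : ℤ, s = t + n * L
  isolated : ∀ t, ∀ᶠ s in 𝓝[≠] t, γ s ∉ X
  direction : ∀ t, γ t ∈ S → ∃ u, HasDirection γ t u
  direction_inj : ∀ s t u, γ s = γ t → γ s ∈ S → HasDirection γ s u → HasDirection γ t u →
    ∃ n : ℤ, s = t + n * L

/-- The curves `γ₁` and `γ₂` have the same trace, and no arc of `γ₂` off `X` is an arc of `γ₁`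
run backwards. -/
structure IsCompatible (γ₁ γ₂ : ℝ → Plane) (L₂ : ℝ) (X : Set Plane) : Prop where
  range_subset : range γ₂ ⊆ range γ₁
  not_antitone : ∀ a b, a < b → b < a + L₂ → (∀ t ∈ Icc a b, γ₂ t ∉ X) → ∀ g : ℝ → ℝ,
    ContinuousOn g (Icc a b) → StrictAntiOn g (Icc a b) → ¬ ∀ t ∈ Icc a b, γ₁ (g t) = γ₂ t

lemma eq_of_eq_add_int_mul {s t L : ℝ} {n : ℤ} (h : s = t + n * L) (hst : |s - t| < L) :
    s = t := by
  have hL : 0 < L := (abs_nonneg _).trans_lt hst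
  have h1 : |(n : ℝ)| * L < 1 * L := by
    rw [one_mul, ← abs_of_pos hL, ← abs_mul, abs_of_pos hL]
    rwa [h, add_sub_cancel_left] at hst
  have h2 : |(n : ℝ)| < 1 := lt_of_mul_lt_mul_right h1 hL.le
  have h3 : |n| < 1 := by exact_mod_cast h2
  obtain rfl : n = 0 := Int.abs_lt_one_iff.1 h3
  simpa using h

namespace IsArcCurve

variable {γ γ₁ γ₂ : ℝ → Plane} {L L₁ L₂ : ℝ} {S S₁ S₂ X : Set Plane}

lemma apply_add_int_mul (h : IsArcCurve γ L S X) (t : ℝ) (n : ℤ) : γ (t + n * L) = γ t :=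
  h.periodic.int_mul n t

lemma exists_int_of_notMem (h : IsArcCurve γ L S X) {s t : ℝ} (hst : γ s = γ t) (hs : γ s ∉ X) :
    ∃ n : ℤ, s = t + n * L :=
  h.inj s t hst fun h' => hs (h.subset h')

lemma eq_of_notMem (h : IsArcCurve γ L S X) {s t : ℝ} (hst : γ s = γ t) (hs : γ s ∉ X)
    (hlt : |s - t| < L) : s = t := by
  obtain ⟨n, hn⟩ := h.exists_int_of_notMem hst hs
  exact eq_of_eq_add_int_mul hn hlt

lemma eventually_notMem (h : IsArcCurve γ L S X) {t : ℝ} (ht : γ t ∉ X) :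
    ∀ᶠ s in 𝓝 t, γ s ∉ X := by
  filter_upwards [eventually_nhdsWithin_iff.1 (h.isolated t)] with s hs
  by_cases hst : s = t
  · rwa [hst]
  · exact hs hst

/-- Compactness: one period of `γ₁` without the `δ`-window has a compact image missing `γ₂ t`, hence
missing `γ₂ s` for `s` near `t`. A parameter of `γ₂ s`, shifted into this period, must then lie in
the window. -/
lemma exists_near (h₁ : IsArcCurve γ₁ L₁ S₁ X) (h₂ : IsArcCurve γ₂ L₂ S₂ X)
    (hr : range γ₂ ⊆ range γ₁) {t t' : ℝ} (ht : γ₁ t' = γ₂ t) (hX : γ₂ t ∉ X) {δ : ℝ}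
    (hδ : 0 < δ) : ∀ᶠ s in 𝓝 t, ∃ τ ∈ Ioo (t' - δ) (t' + δ), γ₁ τ = γ₂ s := by
  have hL := h₁.pos
  set K := γ₁ '' (Icc (t' - L₁ / 2) (t' + L₁ / 2) \ Ioo (t' - δ) (t' + δ)) with hK
  have hKc : IsCompact K := (isCompact_Icc.diff isOpen_Ioo).image h₁.continuous
  have htK : γ₂ t ∉ K := by
    rintro ⟨τ, ⟨hτ, hτ'⟩, he⟩
    have := h₁.eq_of_notMem (he.trans ht.symm) (he ▸ hX)
      (abs_lt.2 ⟨by linarith [hτ.1], by linarith [hτ.2]⟩)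
    subst this
    exact hτ' ⟨by linarith, by linarith⟩
  filter_upwards [h₂.continuous.continuousAt (hKc.isClosed.isOpen_compl.mem_nhds htK)] with s hs
  obtain ⟨τ₀, hτ₀⟩ := hr ⟨s, rfl⟩
  obtain ⟨n, hn, -⟩ := existsUnique_add_zsmul_mem_Ico hL τ₀ (t' - L₁ / 2)
  rw [zsmul_eq_mul] at hn
  have hτ : γ₁ (τ₀ + n * L₁) = γ₂ s := by rw [h₁.apply_add_int_mul, hτ₀]
  refine ⟨τ₀ + n * L₁, ?_, hτ⟩
  by_contra hcon
  exact hs ⟨_, ⟨⟨hn.1, by linarith [hn.2]⟩, hcon⟩, hτ⟩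

/-- A strictly monotone change of parameter between two arc length parameterizations is a
translation. -/
lemma sub_eq_sub (h₁ : IsArcCurve γ₁ L₁ S₁ X) (h₂ : IsArcCurve γ₂ L₂ S₂ X) {a b : ℝ}
    (hab : a ≤ b) {g : ℝ → ℝ} (hg : ContinuousOn g (Icc a b)) (hm : MonotoneOn g (Icc a b))
    (he : ∀ t ∈ Icc a b, γ₁ (g t) = γ₂ t) : g b - g a = b - a := by
  have ha := left_mem_Icc.2 hab
  have hb := right_mem_Icc.2 hab
  have hgab := hm ha hb hab
  have himg : g '' Icc a b = Icc (g a) (g b) := by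
    refine subset_antisymm ?_ (intermediate_value_Icc hab hg)
    rintro _ ⟨t, ht, rfl⟩
    exact ⟨hm ha ht ht.1, hm ht hb ht.2⟩
  -- Variation is invariant under monotone changes of parameter, and on both curves it is the
  -- parameter length.
  have h := eVariationOn.comp_eq_of_monotoneOn γ₁ g hm
  rw [himg, h₁.speed _ _ hgab, eVariationOn.congr (f := γ₁ ∘ g) (g := γ₂) he, h₂.speed _ _ hab,
    ENNReal.ofReal_eq_ofReal_iff (by linarith) (by linarith)] at h
  exact h.symm

/-- Two compatible curves agree up to a translation of the parameter near a common point
off `X`. -/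
lemma eventually_eq (h₁ : IsArcCurve γ₁ L₁ S₁ X) (h₂ : IsArcCurve γ₂ L₂ S₂ X)
    (hC : IsCompatible γ₁ γ₂ L₂ X) {t c : ℝ} (ht : γ₂ t = γ₁ (t + c)) (hX : γ₂ t ∉ X) :
    ∀ᶠ s in 𝓝 t, γ₂ s = γ₁ (s + c) := by
  have hL₁ := h₁.pos
  have hL₂ := h₂.pos
  have ev := (h₁.exists_near h₂ hC.range_subset ht.symm hX (half_pos hL₁)).and
    (h₂.eventually_notMem hX)
  obtain ⟨ε₀, hε₀, hball⟩ := Metric.eventually_nhds_iff.1 ev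
  -- The bound `ε₀ / 2` puts the closed interval inside the ball. The bound `L₂ / 4` keeps it
  -- shorter than a period, as needed for injectivity of `γ₂` and for `not_antitone`.
  set ε := min (ε₀ / 2) (L₂ / 4) with hε
  have hεpos : 0 < ε := lt_min (by linarith) (by linarith)
  have hε1 : ε ≤ ε₀ / 2 := min_le_left _ _
  have hε2 : ε ≤ L₂ / 4 := min_le_right _ _
  have hV : ∀ s ∈ Icc (t - ε) (t + ε), (∃ τ ∈ Ioo (t + c - L₁ / 2) (t + c + L₁ / 2), γ₁ τ = γ₂ s) ∧
      γ₂ s ∉ X := fun s hs => hball (by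
    rw [Real.dist_eq, abs_lt]
    exact ⟨by linarith [hs.1], by linarith [hs.2]⟩)
  have hVX : ∀ s ∈ Icc (t - ε) (t + ε), γ₂ s ∉ X := fun s hs => (hV s hs).2
  choose! g hgI hg using fun s hs => (hV s hs).1
  have huniq : ∀ s ∈ Icc (t - ε) (t + ε), ∀ τ ∈ Ioo (t + c - L₁ / 2) (t + c + L₁ / 2),
      γ₁ τ = γ₂ s → τ = g s := fun s hs τ hτ he =>
    h₁.eq_of_notMem (he.trans (hg s hs).symm) (he ▸ hVX s hs)
      (abs_lt.2 ⟨by linarith [hτ.1, (hgI s hs).2], by linarith [hτ.2, (hgI s hs).1]⟩)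
  -- A parameter close to `g s`, supplied by `exists_near`, must be the value of `g` by uniqueness
  -- in the window of length `L₁`.
  have hcont : ContinuousOn g (Icc (t - ε) (t + ε)) := by
    intro s hs
    refine Metric.continuousWithinAt_iff'.2 fun δ hδ => ?_
    obtain ⟨δ', hδ', hsub⟩ := Metric.isOpen_iff.1 isOpen_Ioo (g s) (hgI s hs)
    have hmin : 0 < min δ δ' := lt_min hδ hδ'
    filter_upwards [mem_nhdsWithin_of_mem_nhds
      (h₁.exists_near h₂ hC.range_subset (hg s hs) (hVX s hs) hmin), self_mem_nhdsWithin]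
      with r hr hrV
    obtain ⟨τ, hτ, he⟩ := hr
    have hd : dist τ (g s) < min δ δ' := by
      rw [Real.dist_eq, abs_lt]
      exact ⟨by linarith [hτ.1], by linarith [hτ.2]⟩
    rw [← huniq r hrV τ (hsub (hd.trans_le (min_le_right _ _))) he]
    exact hd.trans_le (min_le_left _ _)
  have hinj : InjOn g (Icc (t - ε) (t + ε)) := fun s hs r hr he =>
    h₂.eq_of_notMem (by rw [← hg s hs, ← hg r hr, he]) (hVX s hs)
      (abs_lt.2 ⟨by linarith [hs.1, hr.2], by linarith [hs.2, hr.1]⟩)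
  have hmono : StrictMonoOn g (Icc (t - ε) (t + ε)) := by
    refine (hcont.strictMonoOn_of_injOn_Icc' (by linarith) hinj).resolve_right fun hanti => ?_
    exact hC.not_antitone _ _ (by linarith) (by linarith) hVX g hcont hanti hg
  have htV : t ∈ Icc (t - ε) (t + ε) := ⟨by linarith, by linarith⟩
  have hgt : g t = t + c :=
    (huniq t htV _ ⟨by linarith, by linarith⟩ ht.symm).symm
  filter_upwards [Icc_mem_nhds (show t - ε < t by linarith) (show t < t + ε by linarith)]
    with s hs
  have hgs : g s = s + c := by
    rcases le_total t s with hts | hst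
    · have hsub : Icc t s ⊆ Icc (t - ε) (t + ε) := Icc_subset_Icc htV.1 hs.2
      have := h₁.sub_eq_sub h₂ hts (hcont.mono hsub) (hmono.monotoneOn.mono hsub)
        fun r hr => hg r (hsub hr)
      linarith
    · have hsub : Icc s t ⊆ Icc (t - ε) (t + ε) := Icc_subset_Icc hs.1 htV.2
      have := h₁.sub_eq_sub h₂ hst (hcont.mono hsub) (hmono.monotoneOn.mono hsub)
        fun r hr => hg r (hsub hr)
      linarith
  rw [← hg s hs, hgs]

/-- On an interval of parameters off `X`, one curve is a translate of the other. -/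
lemma exists_translation (h₁ : IsArcCurve γ₁ L₁ S₁ X) (h₂ : IsArcCurve γ₂ L₂ S₂ X)
    (hC : IsCompatible γ₁ γ₂ L₂ X) {p q : ℝ} (hpq : p < q) (hX : ∀ s ∈ Ioo p q, γ₂ s ∉ X) :
    ∃ c, ∀ s ∈ Ioo p q, γ₂ s = γ₁ (s + c) := by
  obtain ⟨s₀, hs₀⟩ := exists_between hpq
  obtain ⟨t', ht'⟩ := hC.range_subset ⟨s₀, rfl⟩
  refine ⟨t' - s₀, ?_⟩
  set G : Set ℝ := {s | ∀ᶠ r in 𝓝 s, γ₂ r = γ₁ (r + (t' - s₀))} with hG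
  -- `G` is open by construction. It is relatively closed because equality passes to limits and then
  -- spreads to a neighbourhood by `eventually_eq`.
  have hsub : Ioo p q ⊆ G := by
    refine isPreconnected_Ioo.subset_of_closure_inter_subset isOpen_setOfPred_eventually_nhds
      ⟨s₀, hs₀, h₁.eventually_eq h₂ hC (by simp [ht']) (hX _ hs₀)⟩ ?_
    rintro s ⟨hs, hsI⟩
    refine h₁.eventually_eq h₂ hC ?_ (hX s hsI)
    have hcl : IsClosed {s | γ₂ s = γ₁ (s + (t' - s₀))} :=
      isClosed_eq h₂.continuous (h₁.continuous.comp (continuous_id.add continuous_const))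
    exact closure_minimal (fun r hr => Eventually.self_of_nhds hr) hcl hs
  exact fun s hs => (hsub hs).self_of_nhds

lemma eq_left (h₁ : IsArcCurve γ₁ L₁ S₁ X) (h₂ : IsArcCurve γ₂ L₂ S₂ X) {p T c : ℝ} (hp : p < T)
    (h : ∀ s ∈ Ioo p T, γ₂ s = γ₁ (s + c)) : γ₂ T = γ₁ (T + c) := by
  have hcl : IsClosed {s | γ₂ s = γ₁ (s + c)} :=
    isClosed_eq h₂.continuous (h₁.continuous.comp (continuous_id.add continuous_const))
  refine closure_minimal h hcl ?_
  rw [closure_Ioo hp.ne]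
  exact right_mem_Icc.2 hp.le

lemma eq_right (h₁ : IsArcCurve γ₁ L₁ S₁ X) (h₂ : IsArcCurve γ₂ L₂ S₂ X) {q T c : ℝ} (hq : T < q)
    (h : ∀ s ∈ Ioo T q, γ₂ s = γ₁ (s + c)) : γ₂ T = γ₁ (T + c) := by
  have hcl : IsClosed {s | γ₂ s = γ₁ (s + c)} :=
    isClosed_eq h₂.continuous (h₁.continuous.comp (continuous_id.add continuous_const))
  refine closure_minimal h hcl ?_
  rw [closure_Ioo hq.ne]
  exact left_mem_Icc.2 hq.le

lemma direction_eq_left {p T c : ℝ} (hp : p < T) (h : ∀ s ∈ Ioo p T, γ₂ s = γ₁ (s + c))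
    (hT : γ₂ T = γ₁ (T + c)) {u v : Plane} (hu : HasDirection γ₁ (T + c) u)
    (hv : HasDirection γ₂ T v) : u = v := by
  have hm : Tendsto (fun s => s + c) (𝓝[<] T) (𝓝[<] (T + c)) :=
    tendsto_nhdsWithin_of_tendsto_nhds_of_eventually_within _
      (((continuous_id.add continuous_const).tendsto T).mono_left nhdsWithin_le_nhds)
      (by filter_upwards [self_mem_nhdsWithin] with s hs using add_lt_add_left hs c)
  have h' := (hu.2.comp hm).congr' (f₂ := fun s => ‖γ₂ s - γ₂ T‖⁻¹ • (γ₂ s - γ₂ T)) (by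
    filter_upwards [Ioo_mem_nhdsLT hp] with s hs
    simp [h s hs, hT])
  exact neg_injective (tendsto_nhds_unique h' hv.2)

lemma direction_eq_right {q T c : ℝ} (hq : T < q) (h : ∀ s ∈ Ioo T q, γ₂ s = γ₁ (s + c))
    (hT : γ₂ T = γ₁ (T + c)) {u v : Plane} (hu : HasDirection γ₁ (T + c) u)
    (hv : HasDirection γ₂ T v) : u = v := by
  have hm : Tendsto (fun s => s + c) (𝓝[>] T) (𝓝[>] (T + c)) :=
    tendsto_nhdsWithin_of_tendsto_nhds_of_eventually_within _
      (((continuous_id.add continuous_const).tendsto T).mono_left nhdsWithin_le_nhds)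
      (by filter_upwards [self_mem_nhdsWithin] with s hs using add_lt_add_left hs c)
  have h' := (hu.1.comp hm).congr' (f₂ := fun s => ‖γ₂ s - γ₂ T‖⁻¹ • (γ₂ s - γ₂ T)) (by
    filter_upwards [Ioo_mem_nhdsGT hq] with s hs
    simp [h s hs, hT])
  exact tendsto_nhds_unique h' hv.1

/-- The translations on the two sides of a parameter agree. -/
lemma translation_unique (h₁ : IsArcCurve γ₁ L₁ S₁ X) (h₂ : IsArcCurve γ₂ L₂ S₂ X)
    (hC' : IsCompatible γ₂ γ₁ L₁ X) {p T q c d : ℝ} (hp : p < T) (hq : T < q)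
    (hX : ∀ s ∈ Ioo p T, γ₂ s ∉ X) (hc : ∀ s ∈ Ioo p T, γ₂ s = γ₁ (s + c))
    (hd : ∀ s ∈ Ioo T q, γ₂ s = γ₁ (s + d)) : ∃ n : ℤ, c = d + n * L₁ := by
  have hTc := h₁.eq_left h₂ hp hc
  have hTd := h₁.eq_right h₂ hq hd
  have hTcd : γ₁ (T + c) = γ₁ (T + d) := hTc.symm.trans hTd
  suffices h : ∃ n : ℤ, T + c = T + d + n * L₁ by
    obtain ⟨n, hn⟩ := h
    exact ⟨n, by linarith⟩
  by_cases hS₁ : γ₁ (T + c) ∈ S₁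
  · obtain ⟨u, hu⟩ := h₁.direction _ hS₁
    obtain ⟨v, hv⟩ := h₁.direction _ (hTcd ▸ hS₁)
    by_cases hS₂ : γ₂ T ∈ S₂
    -- Agreement on the left gives `γ₁` the direction of `γ₂` at `T + c`, agreement on the right at
    -- `T + d`. Equal directions identify the two passages.
    · obtain ⟨w, hw⟩ := h₂.direction _ hS₂
      obtain rfl := direction_eq_left hp hc hTc hu hw
      obtain rfl := direction_eq_right hq hd hTd hv hw
      exact h₁.direction_inj _ _ _ hTcd hS₁ hu hv
    -- Here `γ₂` passes only once, so exchange the roles. Just before `T + d`, `γ₁` follows an arc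
    -- of `γ₂` ending at `γ₂ T`, which can only be the arc arriving at `T`. Thus `γ₁ (s + d) = γ₂ s
    -- = γ₁ (s + c)` for some `s < T` off `X`.
    · have hiso : ∀ᶠ s in 𝓝[<] (T + d), γ₁ s ∉ X :=
        (h₁.isolated (T + d)).filter_mono (nhdsWithin_mono _ fun s hs => ne_of_lt hs)
      obtain ⟨r, hr, hrX⟩ := (mem_nhdsLT_iff_exists_Ioo_subset' (show T + d - 1 < T + d by linarith)).1
        hiso
      have hr' : r < T + d := hr
      obtain ⟨e, he⟩ := h₂.exists_translation h₁ hC' hr' hrX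
      have hTe : γ₁ (T + d) = γ₂ (T + d + e) := h₂.eq_left h₁ hr' he
      obtain ⟨n, hn⟩ := h₂.inj T (T + d + e) (hTd.trans hTe) hS₂
      obtain ⟨s, hs⟩ := exists_between (show max p (r - d) < T from max_lt hp (by linarith))
      have hs1 := max_lt_iff.1 hs.1
      have hsI : s ∈ Ioo p T := ⟨hs1.1, hs.2⟩
      have e1 : γ₁ (s + d) = γ₂ s := by
        rw [he (s + d) ⟨by linarith, by linarith [hs.2]⟩,
          ← h₂.apply_add_int_mul (s + d + e) n]
        congr 1
        linarith
      obtain ⟨m, hm⟩ := h₁.exists_int_of_notMem ((hc s hsI).symm.trans e1.symm)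
        (hc s hsI ▸ hX s hsI)
      exact ⟨m, by linarith⟩
  · exact h₁.inj _ _ hTcd hS₁

/-- Compatible closed curves parameterized by arc length are translates of each other. -/
theorem exists_forall_eq (h₁ : IsArcCurve γ₁ L₁ S₁ X) (h₂ : IsArcCurve γ₂ L₂ S₂ X)
    (hC : IsCompatible γ₁ γ₂ L₂ X) (hC' : IsCompatible γ₂ γ₁ L₁ X) :
    ∃ c, ∀ s, γ₂ s = γ₁ (s + c) := by
  have hside : ∀ T, ∃ p q, p < T ∧ T < q ∧ (∀ s ∈ Ioo p T, γ₂ s ∉ X) ∧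
      ∀ s ∈ Ioo T q, γ₂ s ∉ X := by
    intro T
    have hl : ∀ᶠ s in 𝓝[<] T, γ₂ s ∉ X :=
      (h₂.isolated T).filter_mono (nhdsWithin_mono _ fun s hs => ne_of_lt hs)
    have hr : ∀ᶠ s in 𝓝[>] T, γ₂ s ∉ X :=
      (h₂.isolated T).filter_mono (nhdsWithin_mono _ fun s hs => ne_of_gt hs)
    obtain ⟨p, hp, hpX⟩ := (mem_nhdsLT_iff_exists_Ioo_subset' (show T - 1 < T by linarith)).1 hl
    obtain ⟨q, hq, hqX⟩ := (mem_nhdsGT_iff_exists_Ioo_subset' (show T < T + 1 by linarith)).1 hr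
    exact ⟨p, q, hp, hq, hpX, hqX⟩
  have hlocal : ∀ T, ∃ p q, p < T ∧ T < q ∧ ∃ d, (∀ s ∈ Ioo p q, γ₂ s = γ₁ (s + d)) ∧
      ∀ s ∈ Ioo p q, s ≠ T → γ₂ s ∉ X := by
    intro T
    obtain ⟨p, q, hp, hq, hpX, hqX⟩ := hside T
    obtain ⟨c, hc⟩ := h₁.exists_translation h₂ hC hp hpX
    obtain ⟨d, hd⟩ := h₁.exists_translation h₂ hC hq hqX
    obtain ⟨n, hn⟩ := h₁.translation_unique h₂ hC' hp hq hpX hc hd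
    refine ⟨p, q, hp, hq, d, fun s hs => ?_, fun s hs hne => ?_⟩
    · rcases lt_trichotomy s T with h | rfl | h
      · rw [hc s ⟨hs.1, h⟩, hn, ← add_assoc, h₁.apply_add_int_mul]
      · exact h₁.eq_right h₂ hq hd
      · exact hd s ⟨h, hs.2⟩
    · rcases lt_or_gt_of_ne hne with h | h
      · exact hpX s ⟨hs.1, h⟩
      · exact hqX s ⟨h, hs.2⟩
  obtain ⟨p, q, hp, hq, c, hc, -⟩ := hlocal 0
  refine ⟨c, ?_⟩
  have huniv : (univ : Set ℝ) ⊆ {s | ∀ᶠ r in 𝓝 s, γ₂ r = γ₁ (r + c)} := by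
    refine isPreconnected_univ.subset_of_closure_inter_subset isOpen_setOfPred_eventually_nhds
      ⟨0, mem_univ _, by filter_upwards [Ioo_mem_nhds hp hq] with s hs using hc s hs⟩ ?_
    rintro T ⟨hT, -⟩
    obtain ⟨p, q, hp, hq, d, hd, hX⟩ := hlocal T
    obtain ⟨s, hsI, hs⟩ := mem_closure_iff_nhds.1 hT _ (Ioo_mem_nhds hp hq)
    -- Choose `r ≠ T` near `s`, so that `γ₂ r ∉ X`. There the translations `c` and `d` both apply
    -- and must agree modulo `L₁`.
    have hs' : ∀ᶠ r in 𝓝[≠] s, γ₂ r = γ₁ (r + c) ∧ r ∈ Ioo p q ∧ r ≠ T := by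
      refine (eventually_nhdsWithin_of_eventually_nhds hs).and
        ((eventually_nhdsWithin_of_eventually_nhds (isOpen_Ioo.mem_nhds hsI)).and ?_)
      by_cases hsT : s = T
      · subst hsT
        exact self_mem_nhdsWithin
      · exact mem_nhdsWithin_of_mem_nhds (isOpen_ne.mem_nhds hsT)
    obtain ⟨r, hrc, hrI, hrT⟩ := hs'.exists
    obtain ⟨n, hn⟩ := h₁.exists_int_of_notMem (hrc.symm.trans (hd r hrI)) (hrc ▸ hX r hrI hrT)
    filter_upwards [Ioo_mem_nhds hp hq] with x hx
    have hcd : x + c = x + d + n * L₁ := by linarith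
    rw [hd x hx, hcd, h₁.apply_add_int_mul]
  exact fun s => (huniv (mem_univ s)).self_of_nhds

/-- Each length is a period of the other curve. At a point off `X` this makes each a positive
integer multiple of the other. -/
lemma length_eq (h₁ : IsArcCurve γ₁ L₁ S₁ X) (h₂ : IsArcCurve γ₂ L₂ S₂ X) {c : ℝ}
    (hc : ∀ s, γ₂ s = γ₁ (s + c)) : L₁ = L₂ := by
  obtain ⟨s, hs⟩ := (h₂.isolated 0).exists
  have e₁ : γ₁ (s + c + L₂) = γ₁ (s + c) := by
    rw [← hc, add_right_comm, ← hc, h₂.periodic]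
  have e₂ : γ₂ (s + L₁) = γ₂ s := by
    rw [hc, hc, add_right_comm, h₁.periodic]
  obtain ⟨n, hn⟩ := h₁.exists_int_of_notMem e₁ (by rw [e₁, ← hc]; exact hs)
  obtain ⟨m, hm⟩ := h₂.exists_int_of_notMem e₂ (by rw [e₂]; exact hs)
  have hn' : L₂ = n * L₁ := by linarith
  have hm' : L₁ = m * L₂ := by linarith
  have hpos : ∀ {k : ℤ} {a b : ℝ}, 0 < a → 0 < b → b = k * a → a ≤ b := by
    intro k a b ha hb hk
    have hk0 : (0 : ℝ) < k := by
      by_contra hcon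
      nlinarith
    have hk1 : (1 : ℝ) ≤ k := by exact_mod_cast Int.add_one_le_iff.2 (Int.cast_pos.1 hk0)
    nlinarith
  exact le_antisymm (hpos h₁.pos h₂.pos hn') (hpos h₂.pos h₁.pos hm')

end IsArcCurve

end ShapeCurrent

namespace ShapeCurrent

/-! ### Reparameterization by arc length -/

section ArcLength

variable {Ω X : Set Plane} {φ φ₁ φ₂ : UnitAddCircle → Plane}

/-- The signed length of the curve between the parameters `0` and `t`. -/
noncomputable def arcLength (φ : UnitAddCircle → Plane) (t : ℝ) : ℝ :=
  variationOnFromTo (lift φ) univ 0 t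

lemma IsLipImm.locallyBoundedVariationOn (hφ : IsLipImm Ω φ) :
    LocallyBoundedVariationOn (lift φ) univ := by
  obtain ⟨K, hK⟩ := hφ.lipschitz
  exact (lipschitzWith_lift hK).locallyBoundedVariationOn univ

lemma IsLipImm.arcLength_sub (hφ : IsLipImm Ω φ) (a b : ℝ) :
    arcLength φ b - arcLength φ a = variationOnFromTo (lift φ) univ a b := by
  rw [arcLength, arcLength, sub_eq_iff_eq_add', variationOnFromTo.add
    hφ.locallyBoundedVariationOn (mem_univ _) (mem_univ _) (mem_univ _)]

lemma IsLipImm.eVariationOn_eq (hφ : IsLipImm Ω φ) {a b : ℝ} (hab : a ≤ b) :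
    eVariationOn (lift φ) (Icc a b) = ENNReal.ofReal (arcLength φ b - arcLength φ a) := by
  have h := hφ.locallyBoundedVariationOn a b (mem_univ _) (mem_univ _)
  rw [BoundedVariationOn, univ_inter] at h
  rw [hφ.arcLength_sub, variationOnFromTo.eq_of_le _ _ hab, univ_inter, ENNReal.ofReal_toReal h]

lemma IsLipImm.continuous_arcLength (hφ : IsLipImm Ω φ) : Continuous (arcLength φ) := by
  obtain ⟨K, hK⟩ := hφ.lipschitz
  have key : ∀ a b, a ≤ b → arcLength φ b - arcLength φ a ≤ K * (b - a) := by
    intro a b hab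
    have h := ((lipschitzWith_lift hK).lipschitzOnWith (s := univ)).comp_eVariationOn_le
      (g := id) (s := Icc a b) (mapsTo_univ _ _)
    rw [Function.comp_id, eVariationOn_id_Icc, hφ.eVariationOn_eq hab,
      ← ENNReal.ofReal_coe_nnreal, ← ENNReal.ofReal_mul K.coe_nonneg] at h
    exact (ENNReal.ofReal_le_ofReal_iff (mul_nonneg K.coe_nonneg (by linarith))).1 h
  have hmono : ∀ a b, a ≤ b → arcLength φ a ≤ arcLength φ b := fun a b hab => by
    have := variationOnFromTo.nonneg_of_le (lift φ) univ hab
    rw [← hφ.arcLength_sub] at this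
    linarith
  refine (LipschitzWith.of_le_add_mul K fun a b => ?_).continuous
  rcases le_total a b with hab | hab
  · have := hmono a b hab
    have : 0 ≤ (K : ℝ) * dist a b := by positivity
    linarith
  · have := key b a hab
    rw [Real.dist_eq, abs_of_nonneg (by linarith)]
    linarith

/-- Zero variation on `[a, b]` would make the curve constant there, but no value is taken at
parameters accumulating at `a`. -/
lemma HasGoodSelfIntersections.strictMono_arcLength (hs : HasGoodSelfIntersections φ)
    (hφ : IsLipImm Ω φ) : StrictMono (arcLength φ) := by
  intro a b hab
  have hnn := variationOnFromTo.nonneg_of_le (lift φ) univ hab.le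
  have h := hφ.arcLength_sub a b
  rcases hnn.eq_or_lt with h0 | h0
  · exfalso
    have hconst := (variationOnFromTo.eq_zero_iff_of_le hφ.locallyBoundedVariationOn
      (mem_univ _) (mem_univ _) hab.le).1 h0.symm
    have e₁ : ∀ᶠ s in 𝓝[>] a, lift φ s ≠ lift φ a :=
      (hs.eventually_ne hφ a (lift φ a)).filter_mono
        (nhdsWithin_mono _ fun s hs => ne_of_gt hs)
    obtain ⟨s, hs1, hs2⟩ := (e₁.and (Ioo_mem_nhdsGT hab)).exists
    exact hs1 (edist_eq_zero.1 (hconst ⟨mem_univ _, hs2.1.le, hs2.2.le⟩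
      ⟨mem_univ _, le_rfl, hab.le⟩))
  · linarith

lemma IsLipImm.arcLength_add_one (hφ : IsLipImm Ω φ) (t : ℝ) :
    arcLength φ (t + 1) = arcLength φ t + arcLength φ 1 := by
  have h := variationOnFromTo.comp_eq_of_monotoneOn (lift φ) (t := univ) (fun t : ℝ => t + 1)
    (fun a _ b _ hab => by simpa using hab) (mem_univ 0) (mem_univ t)
  have himg : (fun t : ℝ => t + 1) '' univ = univ := by
    rw [image_univ]
    exact (add_right_surjective 1).range_eq
  have hf : lift φ ∘ (fun t : ℝ => t + 1) = lift φ := funext (lift_add_one φ)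
  rw [himg, hf, zero_add, ← hφ.arcLength_sub, ← hφ.arcLength_sub] at h
  have h0 : arcLength φ 0 = 0 := variationOnFromTo.self _ _ _
  linarith

lemma IsLipImm.arcLength_add_int (hφ : IsLipImm Ω φ) (t : ℝ) (n : ℤ) :
    arcLength φ (t + n) = arcLength φ t + n * arcLength φ 1 := by
  have hper : Function.Periodic (fun t => arcLength φ t - t * arcLength φ 1) 1 := fun t => by
    simp only [hφ.arcLength_add_one]
    ring
  have h := hper.int_mul n t
  simp only [mul_one] at h
  linarith

lemma HasGoodSelfIntersections.arcLength_one_pos (hs : HasGoodSelfIntersections φ)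
    (hφ : IsLipImm Ω φ) : 0 < arcLength φ 1 := by
  have h := hs.strictMono_arcLength hφ one_pos
  rwa [arcLength, variationOnFromTo.self] at h

lemma HasGoodSelfIntersections.surjective_arcLength (hs : HasGoodSelfIntersections φ)
    (hφ : IsLipImm Ω φ) : Function.Surjective (arcLength φ) := by
  intro y
  have hpos := hs.arcLength_one_pos hφ
  have h0 : arcLength φ 0 = 0 := variationOnFromTo.self _ _ _
  have hint : ∀ n : ℤ, arcLength φ n = n * arcLength φ 1 := fun n => by
    have := hφ.arcLength_add_int 0 n
    rwa [zero_add, h0, zero_add] at this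
  refine mem_range_of_exists_le_of_exists_ge hφ.continuous_arcLength
    ⟨(⌊y / arcLength φ 1⌋ : ℤ), ?_⟩ ⟨(⌈y / arcLength φ 1⌉ : ℤ), ?_⟩
  · rw [hint, ← le_div_iff₀ hpos]
    exact Int.floor_le _
  · rw [hint, ← div_le_iff₀ hpos]
    exact Int.le_ceil _

/-- The arc length as an order isomorphism of the line. -/
noncomputable def HasGoodSelfIntersections.arcIso (hs : HasGoodSelfIntersections φ)
    (hφ : IsLipImm Ω φ) : ℝ ≃o ℝ :=
  (hs.strictMono_arcLength hφ).orderIsoOfSurjective _ (hs.surjective_arcLength hφ)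

lemma HasGoodSelfIntersections.arcIso_add_int (hs : HasGoodSelfIntersections φ)
    (hφ : IsLipImm Ω φ) (t : ℝ) (n : ℤ) :
    hs.arcIso hφ (t + n) = hs.arcIso hφ t + n * arcLength φ 1 :=
  hφ.arcLength_add_int t n

lemma HasGoodSelfIntersections.arcIso_symm_add (hs : HasGoodSelfIntersections φ)
    (hφ : IsLipImm Ω φ) (t : ℝ) :
    (hs.arcIso hφ).symm (t + arcLength φ 1) = (hs.arcIso hφ).symm t + 1 := by
  rw [OrderIso.symm_apply_eq]
  have h := hs.arcIso_add_int hφ ((hs.arcIso hφ).symm t) 1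
  simpa using h.symm

/-- The parameterization of the curve by arc length. -/
noncomputable def HasGoodSelfIntersections.arcParam (hs : HasGoodSelfIntersections φ)
    (hφ : IsLipImm Ω φ) (t : ℝ) : Plane :=
  lift φ ((hs.arcIso hφ).symm t)

lemma HasDirection.comp_orderIso {f : ℝ → Plane} {t : ℝ} {u : Plane} (σ : ℝ ≃o ℝ)
    (h : HasDirection f (σ t) u) : HasDirection (fun s => f (σ s)) t u := by
  have hσ : Tendsto σ (𝓝 t) (𝓝 (σ t)) := σ.continuous.tendsto t
  have hr : Tendsto σ (𝓝[>] t) (𝓝[>] (σ t)) :=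
    tendsto_nhdsWithin_of_tendsto_nhds_of_eventually_within _ (hσ.mono_left nhdsWithin_le_nhds)
      (by filter_upwards [self_mem_nhdsWithin] with s hs using σ.strictMono hs)
  have hl : Tendsto σ (𝓝[<] t) (𝓝[<] (σ t)) :=
    tendsto_nhdsWithin_of_tendsto_nhds_of_eventually_within _ (hσ.mono_left nhdsWithin_le_nhds)
      (by filter_upwards [self_mem_nhdsWithin] with s hs using σ.strictMono hs)
  exact ⟨h.1.comp hr, h.2.comp hl⟩

/-- Normalized secants are normalized difference quotients, with the sign of `s - t`. -/
lemma hasDirection_unitTangent {t : ℝ} (hd : DifferentiableAt ℝ (lift φ) t)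
    (h0 : deriv (lift φ) t ≠ 0) : HasDirection (lift φ) t (unitTangent φ t) := by
  have hslope := hasDerivAt_iff_tendsto_slope.1 hd.hasDerivAt
  have hn : Tendsto (fun s => ‖slope (lift φ) t s‖⁻¹ • slope (lift φ) t s) (𝓝[≠] t)
      (𝓝 (unitTangent φ t)) :=
    (hslope.norm.inv₀ (norm_ne_zero_iff.2 h0)).smul hslope
  constructor
  · refine (hn.mono_left (nhdsWithin_mono _ fun s hs => ne_of_gt hs)).congr' ?_
    filter_upwards [self_mem_nhdsWithin] with s hs
    have hpos : 0 < s - t := sub_pos.2 hs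
    rw [slope_def_module, norm_smul, norm_inv, Real.norm_of_nonneg hpos.le, smul_smul]
    congr 1
    field_simp
  · refine ((hn.mono_left (nhdsWithin_mono _ fun s hs => ne_of_lt hs)).neg).congr' ?_
    filter_upwards [self_mem_nhdsWithin] with s hs
    have hneg : s - t < 0 := sub_neg.2 hs
    rw [slope_def_module, norm_smul, norm_inv, Real.norm_of_nonpos hneg.le, smul_smul, ← neg_smul]
    congr 1
    have := hneg.ne
    field_simp

lemma HasGoodSelfIntersections.hasDirection_arcParam (hs : HasGoodSelfIntersections φ)
    (hφ : IsLipImm Ω φ) {t : ℝ} (ht : hs.arcParam hφ t ∈ selfIntersections φ) :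
    HasDirection (hs.arcParam hφ) t (unitTangent φ ((hs.arcIso hφ).symm t)) := by
  have hd := (hs.tangent_continuous _ ht).1
  exact (hasDirection_unitTangent hd (hφ.deriv_ne_zero _ hd)).comp_orderIso (hs.arcIso hφ).symm

lemma HasGoodSelfIntersections.isArcCurve (hs : HasGoodSelfIntersections φ) (hφ : IsLipImm Ω φ)
    (hX : X.Finite) (hSX : selfIntersections φ ⊆ X) :
    IsArcCurve (hs.arcParam hφ) (arcLength φ 1) (selfIntersections φ) X := by
  obtain ⟨K, hK⟩ := hφ.lipschitz
  set σ := (hs.arcIso hφ).symm with hσ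
  have hcong : ∀ {s t : ℝ} {n : ℤ}, σ s = σ t + n → s = t + n * arcLength φ 1 := by
    intro s t n h
    have h' := congrArg (hs.arcIso hφ) h
    rwa [hs.arcIso_add_int, hσ, OrderIso.apply_symm_apply, OrderIso.apply_symm_apply] at h'
  refine ⟨(lipschitzWith_lift hK).continuous.comp σ.continuous, hs.arcLength_one_pos hφ,
    fun t => ?_, fun a b hab => ?_, hSX, fun s t hst hns => ?_, fun t => ?_, fun t ht => ?_,
    fun s t u hst hS hu hv => ?_⟩
  · simp only [arcParam, hs.arcIso_symm_add, lift_add_one]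
  · have h := eVariationOn.comp_eq_of_monotoneOn (lift φ) σ (σ.monotone.monotoneOn (Icc a b))
    rw [σ.image_Icc, hφ.eVariationOn_eq (σ.monotone hab)] at h
    have e : ∀ t, arcLength φ (σ t) = t := (hs.arcIso hφ).apply_symm_apply
    rwa [e, e] at h
  · obtain ⟨n, hn⟩ := lift_injective_of_notMem hst hns
    exact ⟨n, hcong hn⟩
  · have hm : Tendsto σ (𝓝[≠] t) (𝓝[≠] (σ t)) :=
      tendsto_nhdsWithin_of_tendsto_nhds_of_eventually_within _
        ((σ.continuous.tendsto t).mono_left nhdsWithin_le_nhds)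
        (by filter_upwards [self_mem_nhdsWithin] with s hs using σ.injective.ne hs)
    exact hm.eventually (hs.eventually_notMem hφ hX (σ t))
  · exact ⟨_, hs.hasDirection_arcParam hφ ht⟩
  -- By uniqueness of limits a direction is the unit tangent, and these differ for different
  -- passages.
  · have e₁ := tendsto_nhds_unique hu.1 (hs.hasDirection_arcParam hφ hS).1
    have e₂ := tendsto_nhds_unique hv.1 (hs.hasDirection_arcParam hφ (hst ▸ hS)).1
    by_contra hne
    refine hs.tangent_distinct (σ s) (σ t) (fun h => hne ?_) hst (e₁.symm.trans e₂)
    obtain ⟨n, hn⟩ := coe_circle_eq_iff.1 h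
    exact ⟨n, hcong hn⟩

/-- The mass statements carry over because conjugation by the increasing arc length isomorphisms
keeps a change of parameter decreasing. -/
lemma SameMass.isCompatible (hM : SameMass Ω φ₁ φ₂) (h₁ : IsLipImm Ω φ₁) (h₂ : IsLipImm Ω φ₂)
    (hs₁ : HasGoodSelfIntersections φ₁) (hs₂ : HasGoodSelfIntersections φ₂)
    (hX : selfIntersections φ₁ ∪ selfIntersections φ₂ ⊆ X) :
    IsCompatible (hs₁.arcParam h₁) (hs₂.arcParam h₂) (arcLength φ₂ 1) X := by
  set s₁ := hs₁.arcIso h₁ with e₁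
  set s₂ := hs₂.arcIso h₂ with e₂
  constructor
  · rintro _ ⟨t, rfl⟩
    obtain ⟨r, hr⟩ := hM.range_subset h₁ h₂ hs₂ ⟨s₂.symm t, rfl⟩
    refine ⟨s₁ r, ?_⟩
    rw [HasGoodSelfIntersections.arcParam, ← e₁, OrderIso.symm_apply_apply]
    exact hr
  · intro a b hab hb hreg g hg hanti hfg
    have hmaps : MapsTo s₂ (Icc (s₂.symm a) (s₂.symm b)) (Icc a b) := fun t ht =>
      ⟨s₂.symm_apply_le.1 ht.1, s₂.le_symm_apply.1 ht.2⟩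
    refine hM.not_antitone h₁ h₂ (a := s₂.symm a) (b := s₂.symm b) (s₂.symm.strictMono hab) ?_
      (fun t ht hmem => ?_) (g := fun t => s₁.symm (g (s₂ t))) ?_ ?_ fun t ht => ?_
    · rw [← hs₂.arcIso_symm_add h₂]
      exact s₂.symm.strictMono hb
    · refine hreg _ (hmaps ht) (hX ?_)
      rwa [HasGoodSelfIntersections.arcParam, ← e₂, OrderIso.symm_apply_apply]
    · exact s₁.symm.continuous.comp_continuousOn (hg.comp s₂.continuous.continuousOn hmaps)
    · exact fun t ht r hr htr =>
        s₁.symm.strictMono (hanti (hmaps ht) (hmaps hr) (s₂.strictMono htr))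
    · have h := hfg _ (hmaps ht)
      rwa [HasGoodSelfIntersections.arcParam, HasGoodSelfIntersections.arcParam, ← e₂,
        OrderIso.symm_apply_apply] at h

end ArcLength

/-! ### Homeomorphisms of the circle -/

/-- The map of the circle induced by a map of the line commuting with the unit translation. -/
noncomputable def circleMapOf (f : ℝ → ℝ) (hf : ∀ t, f (t + 1) = f t + 1) :
    UnitAddCircle → UnitAddCircle :=
  Function.Periodic.lift (f := fun t => (f t : UnitAddCircle)) (c := 1) fun t => by
    simp only [hf, AddCircle.coe_add_period]

lemma circleMapOf_coe (f : ℝ → ℝ) (hf : ∀ t, f (t + 1) = f t + 1) (t : ℝ) :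
    circleMapOf f hf t = (f t : UnitAddCircle) := rfl

lemma continuous_circleMapOf {f : ℝ → ℝ} (hc : Continuous f) (hf : ∀ t, f (t + 1) = f t + 1) :
    Continuous (circleMapOf f hf) :=
  continuous_coinduced_dom.2 ((AddCircle.continuous_mk' 1).comp hc)

/-- The homeomorphism of the circle induced by an increasing homeomorphism of the line commuting
with the unit translation. -/
noncomputable def circleHomeomorphOf (F : ℝ ≃o ℝ) (hF : ∀ t, F (t + 1) = F t + 1) :
    UnitAddCircle ≃ₜ UnitAddCircle where
  toFun := circleMapOf F hF
  invFun := circleMapOf F.symm fun t => by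
    rw [OrderIso.symm_apply_eq, hF, OrderIso.apply_symm_apply]
  left_inv θ := by
    induction θ using QuotientAddGroup.induction_on with
    | H t => rw [circleMapOf_coe, circleMapOf_coe, OrderIso.symm_apply_apply]
  right_inv θ := by
    induction θ using QuotientAddGroup.induction_on with
    | H t => rw [circleMapOf_coe, circleMapOf_coe, OrderIso.apply_symm_apply]
  continuous_toFun := continuous_circleMapOf F.continuous _
  continuous_invFun := continuous_circleMapOf F.symm.continuous _

lemma isOrientationPreserving_circleHomeomorphOf (F : ℝ ≃o ℝ) (hF : ∀ t, F (t + 1) = F t + 1) :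
    IsOrientationPreserving (circleHomeomorphOf F hF) :=
  ⟨F, F.continuous, F.strictMono, hF, fun _ => rfl⟩

lemma SameMass.symm {Ω : Set Plane} {φ₁ φ₂ : UnitAddCircle → Plane} (h : SameMass Ω φ₁ φ₂) :
    SameMass Ω φ₂ φ₁ := fun B hB hBΩ i => (h B hB hBΩ i).symm

theorem SameMass.sameOrientedShape {Ω : Set Plane} {φ₁ φ₂ : UnitAddCircle → Plane}
    (hM : SameMass Ω φ₁ φ₂) (h₁ : IsLipImm Ω φ₁) (h₂ : IsLipImm Ω φ₂)
    (hs₁ : HasGoodSelfIntersections φ₁) (hs₂ : HasGoodSelfIntersections φ₂) :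
    SameOrientedShape φ₁ φ₂ := by
  have hX := hs₁.finite.union hs₂.finite
  have a₁ := hs₁.isArcCurve h₁ hX subset_union_left
  have a₂ := hs₂.isArcCurve h₂ hX subset_union_right
  obtain ⟨c, hc⟩ := a₁.exists_forall_eq a₂ (hM.isCompatible h₁ h₂ hs₁ hs₂ Subset.rfl)
    (hM.symm.isCompatible h₂ h₁ hs₂ hs₁ (union_comm _ _).subset)
  have hL := a₁.length_eq a₂ hc
  -- Pass to arc length on `φ₂`, translate by `c`, and return to the parameter of `φ₁`. Equality of
  -- the lengths makes `F` commute with the unit translation.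
  set F : ℝ ≃o ℝ := (hs₂.arcIso h₂).trans ((OrderIso.addRight c).trans (hs₁.arcIso h₁).symm)
  have hFt : ∀ t, F t = (hs₁.arcIso h₁).symm (hs₂.arcIso h₂ t + c) := fun _ => rfl
  have hF : ∀ t, F (t + 1) = F t + 1 := fun t => by
    have h := hs₂.arcIso_add_int h₂ t 1
    rw [Int.cast_one, one_mul] at h
    rw [hFt, hFt, h, ← hs₁.arcIso_symm_add h₁, hL, add_right_comm]
  refine ⟨circleHomeomorphOf F hF, isOrientationPreserving_circleHomeomorphOf F hF, ?_⟩
  funext θ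
  induction θ using QuotientAddGroup.induction_on with
  | H t =>
    have h := hc (hs₂.arcIso h₂ t)
    rw [HasGoodSelfIntersections.arcParam, OrderIso.symm_apply_apply] at h
    exact h

end ShapeCurrent

theorem mainTheorem8 (Ω : Set ShapeCurrent.Plane) (hΩ_open : IsOpen Ω) (hΩ_conn : IsConnected Ω)
    (ℓ : ℝ) (hℓ : 0 < ℓ) (φ₁ φ₂ : UnitAddCircle → ShapeCurrent.Plane)
    (hφ₁ : ShapeCurrent.IsLipImm Ω φ₁) (hφ₂ : ShapeCurrent.IsLipImm Ω φ₂)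
    (hs₁ : ShapeCurrent.HasGoodSelfIntersections φ₁)
    (hs₂ : ShapeCurrent.HasGoodSelfIntersections φ₂)
    (h : ShapeCurrent.current ℓ Ω φ₁ = ShapeCurrent.current ℓ Ω φ₂) :
    ShapeCurrent.SameOrientedShape φ₁ φ₂ := by
  have hM : ShapeCurrent.SameMass Ω φ₁ φ₂ := fun _ hB hBΩ i =>
    ShapeCurrent.integral_indicator_eq_of_current_eq hℓ hΩ_open hφ₁ hφ₂ h hB hBΩ i
  exact hM.sameOrientedShape hφ₁ hφ₂ hs₁ hs₂
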